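/- **Theorem (Low-Dimensional, Sub-Gaussian).** For a random vector $\mathbf z\in\mathbb R^d$ put $$\|\mathbf z\|_{\psi_2}:=\sup_{\|\mathbf u\|=1}\ \sup_{p\ge 1}\ \frac1{\sqrt p}\left(\mathbb E\,|\langle \mathbf z,\mathbf u\rangle|^p\right)^{1/p}\in[0,\infty],$$ and call $\mathbf z$ sub-gaussian if $\|\mathbf z\|_{\psi_2}<\infty$. For a real symmetric $d\times d$ matrix $A$ let $\lambda_1(A)\ge\dots\ge\lambda_d(A)$ be its eigenvalues, counted with multiplicity. There is an absolute constant $C>0$ such that the following holds. Let $d\le n$, and let $\mathbf x_1,\dots,\mathbf x_n$ be i.i.d. mean-zero random vectors in $\mathbb R^d$ with $\mathbb E\|\mathbf x_i\|^2<\infty$. Let $X\in\mathbb R^{n\times d}$ be the matrix with rows $\mathbf x_1^\top,\dots,\mathbf x_n^\top$, and put $$\hat\Sigma:=\tfrac1n X^\top X,\qquad \Sigma:=\mathbb E\left[\tfrac1n X^\top X\right].$$ Assume that $\Sigma$ is invertible and that the vectors $\mathbf z_i:=\Sigma^{-1/2}\mathbf x_i$ are sub-gaussian, and let $K:=\max_{i}\|\mathbf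 z_i\|_{\psi_2}$. Then for every $t\ge 0$, with probability at least $1-2\exp(-t^2)$, for all $i\in\{1,\dots,d\}$, $$\left|\lambda_i(\hat\Sigma)-\lambda_i(\Sigma)\right|\le C K^2\,\lambda_i(\Sigma)\,\max(\varepsilon,\varepsilon^2),\qquad \varepsilon:=\sqrt{\frac dn}+\frac t{\sqrt n}.$$ -/

import Mathlib

open MeasureTheory ProbabilityTheory
open scoped ENNReal Matrix MatrixOrder

noncomputable section

namespace RelDev

/-- The `n × d` data matrix `X(ω)` whose rows are the vectors `x i ω`. -/
def dataMatrix {Ω : Type*} {d n : ℕ}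
    (x : Fin n → Ω → EuclideanSpace ℝ (Fin d)) (ω : Ω) : Matrix (Fin n) (Fin d) ℝ :=
  Matrix.of fun i j => x i ω j

/-- The empirical second-moment matrix `(1/n) Xᵀ X`. -/
def empiricalCov {Ω : Type*} {d n : ℕ}
    (x : Fin n → Ω → EuclideanSpace ℝ (Fin d)) (ω : Ω) : Matrix (Fin d) (Fin d) ℝ :=
  (1 / (n : ℝ)) • ((dataMatrix x ω)ᵀ * dataMatrix x ω)

/-- The population second-moment matrix `E[(1/n) Xᵀ X]` (entrywise expectation). -/
def populationCov {Ω : Type*} [MeasurableSpace Ω] {d n : ℕ}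
    (x : Fin n → Ω → EuclideanSpace ℝ (Fin d)) (P : Measure Ω) : Matrix (Fin d) (Fin d) ℝ :=
  Matrix.of fun j k => ∫ ω, empiricalCov x ω j k ∂P

theorem empiricalCov_isHermitian {Ω : Type*} {d n : ℕ}
    (x : Fin n → Ω → EuclideanSpace ℝ (Fin d)) (ω : Ω) :
    (empiricalCov x ω).IsHermitian := by
  unfold Matrix.IsHermitian empiricalCov
  simp [Matrix.conjTranspose_eq_transpose_of_trivial, Matrix.transpose_smul,
    Matrix.transpose_mul]

theorem populationCov_isHermitian {Ω : Type*} [MeasurableSpace Ω] {d n : ℕ}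
    (x : Fin n → Ω → EuclideanSpace ℝ (Fin d)) (P : Measure Ω) :
    (populationCov x P).IsHermitian := by
  ext j k
  simp only [populationCov, Matrix.conjTranspose_apply, Matrix.of_apply, star_trivial]
  congr 1
  ext ω
  simpa using (empiricalCov_isHermitian x ω).apply j k

/-- The eigenvalues of a real symmetric matrix with multiplicity, in non-increasing order:
`eig hA 0` is the largest one, `λ₁(A)`. -/
def eig {d : ℕ} {A : Matrix (Fin d) (Fin d) ℝ} (hA : A.IsHermitian) (i : Fin d) : ℝ :=
  hA.eigenvalues₀ (Fin.cast (Fintype.card_fin d).symm i)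

/-- The whitened vectors `z i = Σ^(-1/2) x i`, with `Σ^(-1/2)` the inverse of the positive
semidefinite square root of `Σ`. -/
def whitened {Ω : Type*} [MeasurableSpace Ω] {d n : ℕ}
    (x : Fin n → Ω → EuclideanSpace ℝ (Fin d)) (P : Measure Ω) (i : Fin n) (ω : Ω) :
    EuclideanSpace ℝ (Fin d) :=
  WithLp.toLp 2 ((CFC.sqrt (populationCov x P))⁻¹ *ᵥ (x i ω).ofLp)

/-- The sub-gaussian norm
`sup_{‖u‖ = 1} sup_{p ≥ 1} p^(-1/2) (E |⟨z, u⟩|^p)^(1/p)`, with values in `[0, ∞]`. -/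
def psi2Norm {Ω : Type*} [MeasurableSpace Ω] {d : ℕ}
    (z : Ω → EuclideanSpace ℝ (Fin d)) (P : Measure Ω) : ℝ≥0∞ :=
  ⨆ (u : EuclideanSpace ℝ (Fin d)) (_ : ‖u‖ = 1) (p : ℝ) (_ : 1 ≤ p),
    ENNReal.ofReal (1 / √p) * (∫⁻ ω, ENNReal.ofReal (|inner ℝ (z ω) u| ^ p) ∂P) ^ (1 / p)

/-- A random vector is sub-gaussian if its sub-gaussian norm is finite. -/
def IsSubGaussian {Ω : Type*} [MeasurableSpace Ω] {d : ℕ}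
    (z : Ω → EuclideanSpace ℝ (Fin d)) (P : Measure Ω) : Prop :=
  psi2Norm z P < ∞

end RelDev

end

/-! ### Eigenvalue perturbation and nets of the sphere -/

section LinearAlgebra

variable {E : Type*} [NormedAddCommGroup E] [InnerProductSpace ℝ E]

/-! If `|⟨Σ̂v,v⟩ - ⟨Σv,v⟩| ≤ δ⟨Σv,v⟩` for all `v`, Weyl monotonicity moves every ordered eigenvalue
by at most the relative amount `δ` (`abs_eigenvalues_sub_le`). Substituting `u = Σ^(1/2) v` turns
this into a uniform statement about whitened data: the average of `⟨zᵢ,u⟩²` is within `δ` of 1 on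
the unit sphere.

A `1/2`-net of at most `5^d` points suffices, at the cost of a factor 2 (`abs_inner_le_of_net`). For
fixed `u` the variables `⟨zᵢ,u⟩²` are independent, have mean one and `k`-th moment at most
`(2K²k)^k`, so a Chernoff bound makes a deviation of `10eK² max(ε,ε²)` have probability at most
`2exp(-2nε²)` (`measure_abs_average_sub_one_ge_le`). Since `nε² ≥ d + t²` and `5 ≤ e²`, this
exponent absorbs the size of the net in a union bound. -/

theorem OrthonormalBasis.sum_real_inner_sq {ι : Type*} [Fintype ι] (b : OrthonormalBasis ι ℝ E)
    (v : E) : ∑ i, inner ℝ (b i) v ^ 2 = ‖v‖ ^ 2 := by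
  rw [← b.sum_sq_norm_inner_right v]
  simp

variable [FiniteDimensional ℝ E]

theorem LinearMap.IsSymmetric.inner_apply_self_eq_sum {T : E →ₗ[ℝ] E} (hT : T.IsSymmetric) {n : ℕ}
    (hn : Module.finrank ℝ E = n) (v : E) :
    inner ℝ (T v) v = ∑ i, hT.eigenvalues hn i * inner ℝ (hT.eigenvectorBasis hn i) v ^ 2 := by
  rw [← OrthonormalBasis.sum_inner_mul_inner (hT.eigenvectorBasis hn)]
  refine Finset.sum_congr rfl fun i _ => ?_
  rw [hT v, hT.apply_eigenvectorBasis, real_inner_comm]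
  simp only [RCLike.ofReal_real_eq_id, id_eq, inner_smul_left, conj_trivial]
  rw [real_inner_comm]
  ring_nf

/-- Weyl monotonicity: domination of quadratic forms implies domination of ordered eigenvalues. -/
theorem LinearMap.IsSymmetric.eigenvalues_le_mul_of_inner_le {A B : E →ₗ[ℝ] E}
    (hA : A.IsSymmetric) (hB : B.IsSymmetric) {n : ℕ} (hn : Module.finrank ℝ E = n)
    {c : ℝ} (hc : 0 ≤ c) (h : ∀ v, inner ℝ (B v) v ≤ c * inner ℝ (A v) v) (i : Fin n) :
    hB.eigenvalues hn i ≤ c * hA.eigenvalues hn i := by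
  -- These are `n - 1` linear conditions in dimension `n`. A nonzero solution `v` lies in the span
  -- of the `B`-eigenvectors of index at most `i` and in that of the `A`-eigenvectors of index at
  -- least `i`.
  let f : E →ₗ[ℝ] ({j : Fin n // j ≠ i} → ℝ) := LinearMap.pi fun j =>
    if i < j.1 then (innerSL ℝ (hB.eigenvectorBasis hn j)).toLinearMap
    else (innerSL ℝ (hA.eigenvectorBasis hn j)).toLinearMap
  have hker : f.ker ≠ ⊥ := by
    apply LinearMap.ker_ne_bot_of_finrank_lt
    rw [hn, Module.finrank_fintype_fun_eq_card, Fintype.card_subtype_compl]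
    have := i.2
    simp
    omega
  obtain ⟨v, hv, hv0⟩ := Submodule.exists_mem_ne_zero_of_ne_bot hker
  have hfv (j : {j : Fin n // j ≠ i}) : f v j = 0 := by
    rw [LinearMap.mem_ker.1 hv]; rfl
  have hBv : hB.eigenvalues hn i * ‖v‖ ^ 2 ≤ inner ℝ (B v) v := by
    rw [hB.inner_apply_self_eq_sum hn, ← (hB.eigenvectorBasis hn).sum_real_inner_sq,
      Finset.mul_sum]
    refine Finset.sum_le_sum fun j _ => ?_
    rcases le_or_gt j i with hj | hj
    · exact mul_le_mul_of_nonneg_right (hB.eigenvalues_antitone hn hj) (sq_nonneg _)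
    · have := hfv ⟨j, hj.ne'⟩
      simp only [f, LinearMap.pi_apply, if_pos hj] at this
      replace this : inner ℝ (hB.eigenvectorBasis hn j) v = 0 := this
      simp [this]
  have hAv : inner ℝ (A v) v ≤ hA.eigenvalues hn i * ‖v‖ ^ 2 := by
    rw [hA.inner_apply_self_eq_sum hn, ← (hA.eigenvectorBasis hn).sum_real_inner_sq,
      Finset.mul_sum]
    refine Finset.sum_le_sum fun j _ => ?_
    rcases le_or_gt i j with hj | hj
    · exact mul_le_mul_of_nonneg_right (hA.eigenvalues_antitone hn hj) (sq_nonneg _)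
    · have := hfv ⟨j, hj.ne⟩
      simp only [f, LinearMap.pi_apply, if_neg hj.not_gt] at this
      replace this : inner ℝ (hA.eigenvectorBasis hn j) v = 0 := this
      simp [this]
  have hvpos : 0 < ‖v‖ ^ 2 := by positivity
  refine le_of_mul_le_mul_right ?_ hvpos
  calc _ ≤ _ := hBv
    _ ≤ _ := h v
    _ ≤ c * (hA.eigenvalues hn i * ‖v‖ ^ 2) := mul_le_mul_of_nonneg_left hAv hc
    _ = _ := by ring

/-- A relative perturbation of a positive semidefinite quadratic form perturbs the ordered
eigenvalues by at most the same relative amount. -/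
theorem LinearMap.IsSymmetric.abs_eigenvalues_sub_le {A B : E →ₗ[ℝ] E}
    (hA : A.IsSymmetric) (hB : B.IsSymmetric) {n : ℕ} (hn : Module.finrank ℝ E = n)
    (hA0 : ∀ v, 0 ≤ inner ℝ (A v) v) (hB0 : ∀ v, 0 ≤ inner ℝ (B v) v) {δ : ℝ} (hδ : 0 ≤ δ)
    (h : ∀ v, |inner ℝ (B v) v - inner ℝ (A v) v| ≤ δ * inner ℝ (A v) v) (i : Fin n) :
    |hB.eigenvalues hn i - hA.eigenvalues hn i| ≤ δ * hA.eigenvalues hn i := by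
  have hup : hB.eigenvalues hn i ≤ (1 + δ) * hA.eigenvalues hn i :=
    hA.eigenvalues_le_mul_of_inner_le hB hn (by linarith)
      (fun v => by linarith [(abs_le.1 (h v)).2]) i
  have nonneg {D : E →ₗ[ℝ] E} (hD : D.IsSymmetric) (hD0 : ∀ v, 0 ≤ inner ℝ (D v) v) :
      0 ≤ hD.eigenvalues hn i := by
    have := hD0 (hD.eigenvectorBasis hn i)
    rw [hD.apply_eigenvectorBasis] at this
    simpa [inner_smul_left] using this
  have hA1 := nonneg hA hA0
  have hlow : (1 - δ) * hA.eigenvalues hn i ≤ hB.eigenvalues hn i := by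
    -- For `δ < 1` the lower form bound can be inverted and monotonicity applied with the roles
    -- swapped; for `δ ≥ 1` the left side is nonpositive.
    rcases lt_or_ge δ 1 with h1 | h1
    · have h2 : 0 < 1 - δ := by linarith
      have := hB.eigenvalues_le_mul_of_inner_le hA hn (c := (1 - δ)⁻¹) (by positivity)
        (fun v => by
          rw [le_inv_mul_iff₀ h2]
          linarith [(abs_le.1 (h v)).1]) i
      rwa [le_inv_mul_iff₀ h2] at this
    · exact (mul_nonpos_of_nonpos_of_nonneg (by linarith) hA1).trans (nonneg hB hB0)
  rw [abs_le]
  constructor <;> linarith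

/-- The quadratic form of a symmetric operator is controlled by its values on a `1/2`-net. -/
theorem LinearMap.IsSymmetric.abs_inner_le_of_net {T : E →ₗ[ℝ] E} (hT : T.IsSymmetric)
    {N : Finset E} (hN1 : ∀ u ∈ N, ‖u‖ = 1)
    (hN : ∀ v : E, ‖v‖ = 1 → ∃ u ∈ N, ‖u - v‖ ≤ 1 / 2) {δ : ℝ}
    (h : ∀ u ∈ N, |inner ℝ (T u) u| ≤ δ) (v : E) :
    |inner ℝ (T v) v| ≤ 2 * δ * ‖v‖ ^ 2 := by
  set lam := hT.eigenvalues rfl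
  set b := hT.eigenvectorBasis rfl
  rcases isEmpty_or_nonempty (Fin (Module.finrank ℝ E)) with he | hne
  · rw [hT.inner_apply_self_eq_sum rfl, ← b.sum_real_inner_sq]
    simp
  obtain ⟨i, hi⟩ := Finite.exists_max fun i => |lam i|
  have hmax (w : E) : |inner ℝ (T w) w| ≤ |lam i| * ‖w‖ ^ 2 := by
    rw [hT.inner_apply_self_eq_sum rfl, ← b.sum_real_inner_sq, Finset.mul_sum]
    refine (Finset.abs_sum_le_sum_abs _ _).trans (Finset.sum_le_sum fun j _ => ?_)
    rw [abs_mul, abs_of_nonneg (sq_nonneg (inner ℝ _ w))]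
    exact mul_le_mul_of_nonneg_right (hi j) (sq_nonneg _)
  have hb : ‖b i‖ = 1 := b.orthonormal.1 i
  obtain ⟨u, huN, hu⟩ := hN (b i) hb
  set w := u - b i with hw
  have huw : u = b i + w := by rw [hw]; abel
  have hTb : T (b i) = lam i • b i := hT.apply_eigenvectorBasis rfl i
  have hu1 := hN1 u huN
  -- Both `u` and `b i` are unit vectors, so the cross term is of second order in `‖w‖`. The error
  -- is then `2|lam i|‖w‖² ≤ |lam i|/2`, which is absorbed.
  have hbw : 2 * inner ℝ (b i) w = - ‖w‖ ^ 2 := by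
    have : ‖u‖ ^ 2 = ‖b i‖ ^ 2 + 2 * inner ℝ (b i) w + ‖w‖ ^ 2 := by
      rw [huw, norm_add_sq_real]
    rw [hu1, hb] at this
    linarith
  have hTu : inner ℝ (T u) u = lam i * (1 - ‖w‖ ^ 2) + inner ℝ (T w) w := by
    rw [huw, map_add, inner_add_left, inner_add_right, inner_add_right, hT w (b i), hTb,
      inner_smul_left, inner_smul_left, inner_smul_right, real_inner_self_eq_norm_sq, hb,
      real_inner_comm (b i) w]
    simp only [conj_trivial]
    linear_combination lam i * hbw
  have hw2 : ‖w‖ ^ 2 ≤ 1 / 4 := by nlinarith [norm_nonneg w]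
  have hlam : |lam i| ≤ 2 * δ := by
    have h1 : lam i * (1 - ‖w‖ ^ 2) = inner ℝ (T u) u - inner ℝ (T w) w := by rw [hTu]; ring
    have h2 : |lam i| * (1 - ‖w‖ ^ 2) ≤ δ + |lam i| * ‖w‖ ^ 2 := by
      rw [← abs_of_nonneg (show 0 ≤ 1 - ‖w‖ ^ 2 by linarith), ← abs_mul, h1]
      exact (abs_sub _ _).trans (add_le_add (h u huN) (hmax w))
    nlinarith [abs_nonneg (lam i)]
  exact (hmax v).trans (mul_le_mul_of_nonneg_right hlam (sq_nonneg _))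

/-- A `1/2`-separated subset of the sphere of maximal cardinality is a net, since any uncovered
point could be added to it. Doubling it gives a 1-separated set in the ball of radius 2, whence the
volume bound `5^dim`. -/
theorem exists_finset_sphere_net (E : Type*) [NormedAddCommGroup E] [NormedSpace ℝ E]
    [FiniteDimensional ℝ E] :
    ∃ N : Finset E, (∀ u ∈ N, ‖u‖ = 1) ∧ (∀ v : E, ‖v‖ = 1 → ∃ u ∈ N, ‖u - v‖ ≤ 1 / 2) ∧
      N.card ≤ 5 ^ Module.finrank ℝ E := by
  classical
  let p : Finset E → Prop := fun s =>
    (∀ u ∈ s, ‖u‖ = 1) ∧ ∀ u ∈ s, ∀ v ∈ s, u ≠ v → 1 / 2 ≤ ‖u - v‖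
  have hcard {s : Finset E} (hs : p s) : s.card ≤ 5 ^ Module.finrank ℝ E := by
    rw [← Finset.card_image_of_injective s (smul_right_injective E (two_ne_zero (α := ℝ)))]
    apply Besicovitch.card_le_of_separated
    · simp only [Finset.mem_image]
      rintro _ ⟨u, hu, rfl⟩
      simp [norm_smul, hs.1 u hu]
    · simp only [Finset.mem_image]
      rintro _ ⟨u, hu, rfl⟩ _ ⟨v, hv, rfl⟩ huv
      have := hs.2 u hu v hv (by rintro rfl; exact huv rfl)
      rw [← smul_sub, norm_smul, Real.norm_two]
      linarith
  let q : ℕ → Prop := fun m => ∃ s : Finset E, p s ∧ s.card = m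
  have hq0 : q 0 := ⟨∅, by simp [p], rfl⟩
  obtain ⟨s, hs, hsm⟩ := Nat.findGreatest_spec (P := q) (Nat.zero_le (5 ^ Module.finrank ℝ E)) hq0
  refine ⟨s, hs.1, fun v hv => ?_, hcard hs⟩
  by_contra! hcon
  have hvs : v ∉ s := fun hvs => by
    have := hcon v hvs
    norm_num at this
  have hins : p (insert v s) := by
    refine ⟨fun u hu => ?_, fun u hu w hw huw => ?_⟩
    · rcases Finset.mem_insert.1 hu with rfl | hu
      exacts [hv, hs.1 u hu]
    · rcases Finset.mem_insert.1 hu with rfl | hu' <;>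
        rcases Finset.mem_insert.1 hw with rfl | hw'
      · exact absurd rfl huw
      · rw [norm_sub_rev]; exact (hcon w hw').le
      · exact (hcon u hu').le
      · exact hs.2 u hu' w hw' huw
  have := Nat.le_findGreatest (P := q) (hcard hins) ⟨_, hins, rfl⟩
  rw [← hsm, Finset.card_insert_of_notMem hvs] at this
  omega

end LinearAlgebra

/-! ### Chernoff bounds for sub-exponential variables -/

section Probability

variable {Ω : Type*} [MeasurableSpace Ω] {P : Measure Ω}

/-- For `s < 0` this is `y ≤ sinh y`. The remainder depends only on `|s|`, so one estimate serves
both tails. -/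
theorem Real.exp_mul_le_one_add_add {s y : ℝ} (hy : 0 ≤ y) :
    Real.exp (s * y) ≤ 1 + s * y + (Real.exp (|s| * y) - 1 - |s| * y) := by
  rcases le_total 0 s with hs | hs
  · rw [abs_of_nonneg hs]; linarith
  · rw [abs_of_nonpos hs]
    have h := Real.self_le_sinh_iff.2 (mul_nonneg (neg_nonneg.2 hs) hy)
    rw [Real.sinh_eq] at h
    have : -(-s * y) = s * y := by ring
    rw [this] at h
    linarith

theorem Real.hasSum_exp_sub_one_sub (y : ℝ) :
    HasSum (fun k : ℕ => y ^ (k + 2) / ((k + 2).factorial : ℝ)) (Real.exp y - 1 - y) := by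
  have h := NormedSpace.expSeries_div_hasSum_exp (𝔸 := ℝ) y
  rw [← Real.exp_eq_exp_ℝ] at h
  have := (hasSum_nat_add_iff' 2).2 h
  simpa [Finset.sum_range_succ, sub_sub] using this

/-- Integrate the exponential series term by term. Because `k^k / k! ≤ e^k`, the `k`-th term is at
most `θ^k`; the geometric tail from `k = 2` sums to at most `2θ²`. -/
theorem lintegral_exp_sub_one_sub_le {Y : Ω → ℝ} (hY : AEMeasurable Y P) (hY0 : ∀ ω, 0 ≤ Y ω)
    {M : ℝ} (hM : 0 ≤ M)
    (hmom : ∀ k : ℕ, 1 ≤ k → ∫⁻ ω, ENNReal.ofReal (Y ω ^ k) ∂P ≤ ENNReal.ofReal ((2 * M * k) ^ k))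
    {s θ : ℝ} (hs : 0 ≤ s) (hθ : 2 * Real.exp 1 * M * s = θ) (hθ2 : θ ≤ 1 / 2) :
    ∫⁻ ω, ENNReal.ofReal (Real.exp (s * Y ω) - 1 - s * Y ω) ∂P ≤ ENNReal.ofReal (2 * θ ^ 2) := by
  have hθ0 : 0 ≤ θ := by rw [← hθ]; positivity
  have h1 (ω : Ω) : ENNReal.ofReal (Real.exp (s * Y ω) - 1 - s * Y ω) =
      ∑' k : ℕ, ENNReal.ofReal ((s * Y ω) ^ (k + 2) / ((k + 2).factorial : ℝ)) := by
    have h := Real.hasSum_exp_sub_one_sub (s * Y ω)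
    have h0 := mul_nonneg hs (hY0 ω)
    rw [← h.tsum_eq, ENNReal.ofReal_tsum_of_nonneg (fun k => by positivity) h.summable]
  have hgeo : HasSum (fun k : ℕ => θ ^ (k + 2)) (θ ^ 2 * (1 - θ)⁻¹) := by
    simpa [pow_add, mul_comm] using
      (hasSum_geometric_of_lt_one hθ0 (by linarith)).mul_left (θ ^ 2)
  simp_rw [h1]
  rw [lintegral_tsum (fun k => by fun_prop)]
  calc _ ≤ ∑' k : ℕ, ENNReal.ofReal (θ ^ (k + 2)) := by
        refine ENNReal.tsum_le_tsum fun k => ?_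
        have h2 (ω : Ω) : ENNReal.ofReal ((s * Y ω) ^ (k + 2) / ((k + 2).factorial : ℝ)) =
            ENNReal.ofReal (s ^ (k + 2) / ((k + 2).factorial : ℝ)) *
              ENNReal.ofReal (Y ω ^ (k + 2)) := by
          rw [← ENNReal.ofReal_mul (by positivity)]
          congr 1
          ring
        simp_rw [h2]
        rw [lintegral_const_mul'' _ (by fun_prop)]
        refine (mul_le_mul_right (hmom (k + 2) (by omega)) _).trans ?_
        rw [← ENNReal.ofReal_mul (by positivity)]
        refine ENNReal.ofReal_le_ofReal ?_
        have h3 := Real.pow_div_factorial_le_exp _ (Nat.cast_nonneg (α := ℝ) (k + 2)) (k + 2)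
        have h4 : Real.exp ((k + 2 : ℕ) : ℝ) = Real.exp 1 ^ (k + 2) := by
          rw [← Real.exp_nat_mul, mul_one]
        rw [h4] at h3
        calc _ = (2 * M * s) ^ (k + 2) *
              (((k + 2 : ℕ) : ℝ) ^ (k + 2) / ((k + 2).factorial : ℝ)) := by
              rw [mul_pow (2 * M), mul_pow (2 * M)]; ring
          _ ≤ (2 * M * s) ^ (k + 2) * Real.exp 1 ^ (k + 2) :=
              mul_le_mul_of_nonneg_left h3 (by positivity)
          _ = θ ^ (k + 2) := by rw [← mul_pow, ← hθ]; ring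
    _ = ENNReal.ofReal (θ ^ 2 * (1 - θ)⁻¹) := by
        rw [← hgeo.tsum_eq, ENNReal.ofReal_tsum_of_nonneg (fun k => by positivity) hgeo.summable]
    _ ≤ _ := by
        refine ENNReal.ofReal_le_ofReal ?_
        rw [mul_comm]
        refine mul_le_mul_of_nonneg_right ?_ (sq_nonneg _)
        rw [inv_le_comm₀ (by linarith) (by norm_num)]
        linarith

/-- A nonnegative variable of mean one with sub-exponential moments has a moment generating
function that is quadratically close to that of a constant near the origin. -/
theorem integrable_exp_mul_and_mgf_le [IsProbabilityMeasure P] {Y : Ω → ℝ}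
    (hYint : Integrable Y P) (hY0 : ∀ ω, 0 ≤ Y ω) (hY1 : ∫ ω, Y ω ∂P = 1) {M : ℝ} (hM : 0 ≤ M)
    (hmom : ∀ k : ℕ, 1 ≤ k → ∫⁻ ω, ENNReal.ofReal (Y ω ^ k) ∂P ≤ ENNReal.ofReal ((2 * M * k) ^ k))
    {s θ : ℝ} (hθ : 2 * Real.exp 1 * M * |s| = θ) (hθ2 : θ ≤ 1 / 2) :
    Integrable (fun ω => Real.exp (s * Y ω)) P ∧ mgf Y P s ≤ Real.exp (s + 2 * θ ^ 2) := by
  have hYm := hYint.aemeasurable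
  have hR := lintegral_exp_sub_one_sub_le hYm hY0 hM hmom (abs_nonneg s) hθ hθ2
  have hR0 : 0 ≤ᵐ[P] fun ω => Real.exp (|s| * Y ω) - 1 - |s| * Y ω :=
    Filter.Eventually.of_forall fun ω => by
      have := Real.add_one_le_exp (|s| * Y ω)
      simp only [Pi.zero_apply]
      linarith
  have hRm : AEStronglyMeasurable (fun ω => Real.exp (|s| * Y ω) - 1 - |s| * Y ω) P :=
    AEMeasurable.aestronglyMeasurable (by fun_prop)
  have hRint : Integrable (fun ω => Real.exp (|s| * Y ω) - 1 - |s| * Y ω) P :=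
    ⟨hRm, (hasFiniteIntegral_iff_ofReal hR0).2 (hR.trans_lt ENNReal.ofReal_lt_top)⟩
  have hRle : ∫ ω, (Real.exp (|s| * Y ω) - 1 - |s| * Y ω) ∂P ≤ 2 * θ ^ 2 := by
    rw [integral_eq_lintegral_of_nonneg_ae hR0 hRm]
    exact ENNReal.toReal_le_of_le_ofReal (by positivity) hR
  have hdom : Integrable (fun ω => 1 + s * Y ω + (Real.exp (|s| * Y ω) - 1 - |s| * Y ω)) P :=
    ((integrable_const 1).add (hYint.const_mul s)).add hRint
  have hexp : Integrable (fun ω => Real.exp (s * Y ω)) P :=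
    hdom.mono' (AEMeasurable.aestronglyMeasurable (by fun_prop))
      (Filter.Eventually.of_forall fun ω => by
        rw [Real.norm_of_nonneg (Real.exp_pos _).le]
        exact Real.exp_mul_le_one_add_add (hY0 ω))
  refine ⟨hexp, ?_⟩
  calc mgf Y P s ≤ ∫ ω, (1 + s * Y ω + (Real.exp (|s| * Y ω) - 1 - |s| * Y ω)) ∂P :=
        integral_mono hexp hdom fun ω => Real.exp_mul_le_one_add_add (hY0 ω)
    _ = 1 + s + ∫ ω, (Real.exp (|s| * Y ω) - 1 - |s| * Y ω) ∂P := by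
        rw [integral_add (f := fun ω => 1 + s * Y ω)
          ((integrable_const 1).add (hYint.const_mul s)) hRint,
          integral_add (integrable_const 1) (hYint.const_mul s), integral_const_mul, hY1]
        simp
    _ ≤ (s + 2 * θ ^ 2) + 1 := by linarith
    _ ≤ _ := Real.add_one_le_exp _

/-- Bernstein-type deviation bound for averages of independent sub-exponential variables of mean
one. -/
theorem measure_abs_average_sub_one_ge_le [IsProbabilityMeasure P] {n : ℕ} (hn : 0 < n)
    {Y : Fin n → Ω → ℝ} (hind : iIndepFun Y P)
    (hYint : ∀ i, Integrable (Y i) P) (hY0 : ∀ i ω, 0 ≤ Y i ω) (hY1 : ∀ i, ∫ ω, Y i ω ∂P = 1)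
    {M : ℝ} (hM : 0 < M)
    (hmom : ∀ i, ∀ k : ℕ, 1 ≤ k →
      ∫⁻ ω, ENNReal.ofReal (Y i ω ^ k) ∂P ≤ ENNReal.ofReal ((2 * M * k) ^ k))
    {ε : ℝ} (hε : 0 ≤ ε) :
    P.real {ω | 10 * Real.exp 1 * M * max ε (ε ^ 2) ≤ |(1 / (n : ℝ)) * ∑ i, Y i ω - 1|} ≤
      2 * Real.exp (-(2 * (n * ε ^ 2))) := by
  set e := Real.exp 1 with he
  have he0 : 0 < e := Real.exp_pos 1
  -- The cap at 1 keeps `θ ≤ 1/2`. With `min ε 1 * max ε ε² = ε²`, the gain is `sD = (5/2)ε²`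
  -- against a loss `2θ² ≤ ε²/2`, leaving the exponent `-2nε²`.
  set θ := min ε 1 / 2 with hθ
  have hθ0 : 0 ≤ θ := by positivity
  have hθ2 : θ ≤ 1 / 2 := by rw [hθ]; linarith [min_le_right ε 1]
  set s := θ / (2 * e * M) with hs
  have hs0 : 0 ≤ s := by positivity
  have hsθ : 2 * e * M * s = θ := by rw [hs]; field_simp
  have hn' : (0 : ℝ) < n := by exact_mod_cast hn
  set D := 10 * e * M * max ε (ε ^ 2) with hD
  have hminmax : min ε 1 * max ε (ε ^ 2) = ε ^ 2 := by
    rcases le_total ε 1 with h | h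
    · rw [min_eq_left h, max_eq_left (by nlinarith)]; ring
    · rw [min_eq_right h, max_eq_right (by nlinarith)]; ring
  have hsD : s * D = 5 / 2 * ε ^ 2 := by
    rw [← hminmax, hs, hD, hθ]; field_simp; ring
  have hθε : 2 * θ ^ 2 ≤ 1 / 2 * ε ^ 2 := by
    have h1 : 0 ≤ min ε 1 := le_min hε zero_le_one
    have h2 := min_le_left ε 1
    rw [hθ]; nlinarith
  have hYm (i) : AEMeasurable (Y i) P := (hYint i).aemeasurable
  have hsum {r : ℝ} (hr : |r| = s) :
      Integrable (fun ω => Real.exp (r * (∑ i, Y i) ω)) P ∧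
        mgf (∑ i, Y i) P r ≤ Real.exp (n * (r + 2 * θ ^ 2)) := by
    have hi (i) := integrable_exp_mul_and_mgf_le (hYint i) (hY0 i) (hY1 i) hM.le (hmom i)
      (s := r) (θ := θ) (by rw [hr, hsθ]) hθ2
    have hmgf : mgf (∑ i, Y i) P r = ∏ i, mgf (Y i) P r := hind.mgf_sum₀ hYm Finset.univ
    constructor
    -- A non-integrable exponential would have `mgf` equal to 0, so positivity of the product yields
    -- integrability.
    · have hpos : 0 < mgf (∑ i, Y i) P r := by
        rw [hmgf]
        exact Finset.prod_pos fun i _ => mgf_pos (hi i).1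
      exact mgf_pos_iff.1 hpos
    · rw [hmgf]
      calc _ ≤ ∏ _i : Fin n, Real.exp (r + 2 * θ ^ 2) :=
            Finset.prod_le_prod (fun i _ => mgf_nonneg) fun i _ => (hi i).2
        _ = _ := by simp [← Real.exp_nat_mul]
  have hup := hsum (abs_of_nonneg hs0)
  have hlo := hsum (r := -s) (by rw [abs_neg, abs_of_nonneg hs0])
  have h1 := measure_ge_le_exp_mul_mgf (n * (1 + D)) hs0 hup.1
  have h2 := measure_le_le_exp_mul_mgf (n * (1 - D)) (neg_nonpos.2 hs0) hlo.1
  have hsub : {ω | D ≤ |(1 / (n : ℝ)) * ∑ i, Y i ω - 1|} ⊆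
      {ω | n * (1 + D) ≤ (∑ i, Y i) ω} ∪ {ω | (∑ i, Y i) ω ≤ n * (1 - D)} := by
    intro ω hω
    simp only [Set.mem_ofPred_eq, Set.mem_union, Finset.sum_apply] at hω ⊢
    have hdiv : (n : ℝ) * (1 / (n : ℝ) * ∑ i, Y i ω) = ∑ i, Y i ω := by field_simp
    rcases le_abs.1 hω with h | h
    · left
      rw [← hdiv]
      exact mul_le_mul_of_nonneg_left (by linarith) hn'.le
    · right
      rw [← hdiv]
      exact mul_le_mul_of_nonneg_left (by linarith) hn'.le
  have hb1 : Real.exp (-s * (n * (1 + D))) * mgf (∑ i, Y i) P s ≤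
      Real.exp (-(2 * (n * ε ^ 2))) := by
    refine (mul_le_mul_of_nonneg_left hup.2 (Real.exp_pos _).le).trans ?_
    rw [← Real.exp_add]
    refine Real.exp_le_exp.2 ?_
    calc _ = n * (2 * θ ^ 2 - s * D) := by ring
      _ ≤ n * (1 / 2 * ε ^ 2 - 5 / 2 * ε ^ 2) :=
          mul_le_mul_of_nonneg_left (by linarith) hn'.le
      _ = _ := by ring
  have hb2 : Real.exp (-(-s) * (n * (1 - D))) * mgf (∑ i, Y i) P (-s) ≤
      Real.exp (-(2 * (n * ε ^ 2))) := by
    refine (mul_le_mul_of_nonneg_left hlo.2 (Real.exp_pos _).le).trans ?_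
    rw [← Real.exp_add]
    refine Real.exp_le_exp.2 ?_
    calc _ = n * (2 * θ ^ 2 - s * D) := by ring
      _ ≤ n * (1 / 2 * ε ^ 2 - 5 / 2 * ε ^ 2) :=
          mul_le_mul_of_nonneg_left (by linarith) hn'.le
      _ = _ := by ring
  calc _ ≤ _ := measureReal_mono hsub
    _ ≤ _ := measureReal_union_le _ _
    _ ≤ _ := by linarith

end Probability

namespace RelDev

/-! ### Quadratic forms of the covariance matrices -/

section QuadraticForms

variable {Ω : Type*} {d n : ℕ}

theorem inner_toEuclideanLin_empiricalCov (x : Fin n → Ω → EuclideanSpace ℝ (Fin d)) (ω : Ω)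
    (v : EuclideanSpace ℝ (Fin d)) :
    inner ℝ (Matrix.toEuclideanLin (empiricalCov x ω) v) v =
      (1 / (n : ℝ)) * ∑ i, inner ℝ (x i ω) v ^ 2 := by
  have h1 : inner ℝ (Matrix.toEuclideanLin (empiricalCov x ω) v) v =
      v.ofLp ⬝ᵥ (empiricalCov x ω *ᵥ v.ofLp) := by
    rw [EuclideanSpace.inner_eq_star_dotProduct]
    simp [Matrix.toLpLin_apply]
  have h2 (i : Fin n) : inner ℝ (x i ω) v = (dataMatrix x ω *ᵥ v.ofLp) i := by
    rw [EuclideanSpace.inner_eq_star_dotProduct, dotProduct_comm]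
    simp [dataMatrix, Matrix.mulVec, dotProduct]
  rw [h1, empiricalCov, Matrix.smul_mulVec, dotProduct_smul, ← Matrix.mulVec_mulVec,
    Matrix.dotProduct_mulVec, Matrix.vecMul_transpose, smul_eq_mul]
  simp only [h2, dotProduct, sq]

theorem inner_toEuclideanLin_self (A : Matrix (Fin d) (Fin d) ℝ) (v : EuclideanSpace ℝ (Fin d)) :
    inner ℝ (Matrix.toEuclideanLin A v) v = ∑ j, ∑ k, v j * v k * A j k := by
  rw [EuclideanSpace.inner_eq_star_dotProduct]
  simp only [Matrix.toLpLin_apply, dotProduct, Matrix.mulVec, Pi.star_apply, star_trivial,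
    Finset.mul_sum]
  exact Finset.sum_congr rfl fun j _ => Finset.sum_congr rfl fun k _ => by ring

variable [MeasurableSpace Ω] {P : Measure Ω}

theorem integrable_inner_sq {z : Ω → EuclideanSpace ℝ (Fin d)} (hz : MemLp z 2 P)
    (v : EuclideanSpace ℝ (Fin d)) : Integrable (fun ω => inner ℝ (z ω) v ^ 2) P :=
  (hz.inner_const (𝕜 := ℝ) v).integrable_sq

theorem integrable_empiricalCov {x : Fin n → Ω → EuclideanSpace ℝ (Fin d)}
    (hx : ∀ i, MemLp (x i) 2 P) (j k : Fin d) :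
    Integrable (fun ω => empiricalCov x ω j k) P := by
  have hcoord (i : Fin n) (j : Fin d) : MemLp (fun ω => x i ω j) 2 P := by
    simpa [EuclideanSpace.inner_single_right] using
      (hx i).inner_const (𝕜 := ℝ) (EuclideanSpace.single j (1 : ℝ))
  simp only [empiricalCov, dataMatrix, Matrix.smul_apply, Matrix.mul_apply,
    Matrix.transpose_apply, Matrix.of_apply, smul_eq_mul]
  exact (integrable_finsetSum _ fun i _ => (hcoord i j).integrable_mul (hcoord i k)).const_mul _

theorem inner_toEuclideanLin_populationCov {x : Fin n → Ω → EuclideanSpace ℝ (Fin d)}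
    (hx : ∀ i, MemLp (x i) 2 P) (v : EuclideanSpace ℝ (Fin d)) :
    inner ℝ (Matrix.toEuclideanLin (populationCov x P) v) v =
      (1 / (n : ℝ)) * ∑ i, ∫ ω, inner ℝ (x i ω) v ^ 2 ∂P := by
  have h : ∫ ω, inner ℝ (Matrix.toEuclideanLin (empiricalCov x ω) v) v ∂P =
      inner ℝ (Matrix.toEuclideanLin (populationCov x P) v) v := by
    simp only [inner_toEuclideanLin_self]
    rw [integral_finsetSum _ fun j _ => integrable_finsetSum _ fun k _ =>
      (integrable_empiricalCov hx j k).const_mul _]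
    refine Finset.sum_congr rfl fun j _ => ?_
    rw [integral_finsetSum _ fun k _ => (integrable_empiricalCov hx j k).const_mul _]
    refine Finset.sum_congr rfl fun k _ => ?_
    rw [integral_const_mul, populationCov, Matrix.of_apply]
  rw [← h]
  simp only [inner_toEuclideanLin_empiricalCov]
  rw [integral_const_mul, integral_finsetSum _ fun i _ => integrable_inner_sq (hx i) v]

theorem integral_inner_sq_eq {x : Fin n → Ω → EuclideanSpace ℝ (Fin d)}
    (hx : ∀ i, MemLp (x i) 2 P) (hid : ∀ i j, IdentDistrib (x i) (x j) P P) (i : Fin n)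
    (v : EuclideanSpace ℝ (Fin d)) :
    ∫ ω, inner ℝ (x i ω) v ^ 2 ∂P =
      inner ℝ (Matrix.toEuclideanLin (populationCov x P) v) v := by
  have hn : (n : ℝ) ≠ 0 := by
    have := i.pos
    positivity
  have h (j : Fin n) : ∫ ω, inner ℝ (x j ω) v ^ 2 ∂P = ∫ ω, inner ℝ (x i ω) v ^ 2 ∂P :=
    ((hid j i).comp (u := fun y => inner ℝ y v ^ 2) (by fun_prop)).integral_eq
  rw [inner_toEuclideanLin_populationCov hx]
  simp only [h, Finset.sum_const, Finset.card_univ, Fintype.card_fin, nsmul_eq_mul]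
  field_simp

theorem populationCov_posSemidef {x : Fin n → Ω → EuclideanSpace ℝ (Fin d)}
    (hx : ∀ i, MemLp (x i) 2 P) : (populationCov x P).PosSemidef := by
  refine Matrix.PosSemidef.of_dotProduct_mulVec_nonneg (populationCov_isHermitian x P) fun v => ?_
  have h := inner_toEuclideanLin_populationCov hx (WithLp.toLp 2 v)
  rw [EuclideanSpace.inner_eq_star_dotProduct] at h
  have h0 : 0 ≤ (1 / (n : ℝ)) * ∑ i, ∫ ω, inner ℝ (x i ω) (WithLp.toLp 2 v) ^ 2 ∂P :=
    mul_nonneg (by positivity) (Finset.sum_nonneg fun i _ => integral_nonneg fun ω => sq_nonneg _)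
  rw [← h] at h0
  simpa [Matrix.toLpLin_apply, dotProduct_comm] using h0

end QuadraticForms

/-! ### Whitening and deviation in a fixed direction -/

section Whitening

variable {Ω : Type*} [MeasurableSpace Ω] {P : Measure Ω} {d n : ℕ}
  {x : Fin n → Ω → EuclideanSpace ℝ (Fin d)}

theorem sqrt_mul_sqrt_populationCov (hx : ∀ i, MemLp (x i) 2 P) :
    CFC.sqrt (populationCov x P) * CFC.sqrt (populationCov x P) = populationCov x P :=
  CFC.sqrt_mul_sqrt_self _ (populationCov_posSemidef hx).nonneg

theorem sqrt_populationCov_isHermitian : (CFC.sqrt (populationCov x P)).IsHermitian :=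
  (Matrix.nonneg_iff_posSemidef.1 (CFC.sqrt_nonneg (populationCov x P))).isHermitian

theorem isUnit_det_sqrt_populationCov (hx : ∀ i, MemLp (x i) 2 P)
    (hcov : IsUnit (populationCov x P)) : IsUnit (CFC.sqrt (populationCov x P)).det := by
  have h := (Matrix.isUnit_iff_isUnit_det _).1 hcov
  rw [← sqrt_mul_sqrt_populationCov hx, Matrix.det_mul] at h
  exact isUnit_of_mul_isUnit_left h

theorem inner_toEuclideanLin_left {S : Matrix (Fin d) (Fin d) ℝ} (hS : S.IsHermitian)
    (u v : EuclideanSpace ℝ (Fin d)) :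
    inner ℝ (Matrix.toEuclideanLin S u) v = inner ℝ u (Matrix.toEuclideanLin S v) :=
  Matrix.isSymmetric_toEuclideanLin_iff.2 hS u v

theorem inner_whitened (i : Fin n) (ω : Ω) (u : EuclideanSpace ℝ (Fin d)) :
    inner ℝ (whitened x P i ω) u =
      inner ℝ (x i ω) (Matrix.toEuclideanLin (CFC.sqrt (populationCov x P))⁻¹ u) :=
  inner_toEuclideanLin_left sqrt_populationCov_isHermitian.inv (x i ω) u

theorem toEuclideanLin_mul_apply (A B : Matrix (Fin d) (Fin d) ℝ)
    (v : EuclideanSpace ℝ (Fin d)) :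
    Matrix.toEuclideanLin A (Matrix.toEuclideanLin B v) = Matrix.toEuclideanLin (A * B) v := by
  simp [Matrix.toLpLin_apply]

theorem norm_sq_sqrt_populationCov (hx : ∀ i, MemLp (x i) 2 P) (v : EuclideanSpace ℝ (Fin d)) :
    ‖Matrix.toEuclideanLin (CFC.sqrt (populationCov x P)) v‖ ^ 2 =
      inner ℝ (Matrix.toEuclideanLin (populationCov x P) v) v := by
  rw [← real_inner_self_eq_norm_sq, ← inner_toEuclideanLin_left sqrt_populationCov_isHermitian,
    toEuclideanLin_mul_apply, sqrt_mul_sqrt_populationCov hx]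

theorem toEuclideanLin_inv_apply_self {S : Matrix (Fin d) (Fin d) ℝ} (hS : IsUnit S.det)
    (v : EuclideanSpace ℝ (Fin d)) :
    Matrix.toEuclideanLin S⁻¹ (Matrix.toEuclideanLin S v) = v := by
  rw [toEuclideanLin_mul_apply, Matrix.nonsing_inv_mul _ hS]
  simp

theorem toEuclideanLin_apply_inv_self {S : Matrix (Fin d) (Fin d) ℝ} (hS : IsUnit S.det)
    (v : EuclideanSpace ℝ (Fin d)) :
    Matrix.toEuclideanLin S (Matrix.toEuclideanLin S⁻¹ v) = v := by
  rw [toEuclideanLin_mul_apply, Matrix.mul_nonsing_inv _ hS]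
  simp

theorem integrable_inner_whitened_sq (hx : ∀ i, MemLp (x i) 2 P) (i : Fin n)
    (u : EuclideanSpace ℝ (Fin d)) :
    Integrable (fun ω => inner ℝ (whitened x P i ω) u ^ 2) P := by
  simp only [inner_whitened]
  exact integrable_inner_sq (hx i) _

theorem integral_inner_whitened_sq (hx : ∀ i, MemLp (x i) 2 P)
    (hid : ∀ i j, IdentDistrib (x i) (x j) P P) (hcov : IsUnit (populationCov x P)) (i : Fin n)
    (u : EuclideanSpace ℝ (Fin d)) :
    ∫ ω, inner ℝ (whitened x P i ω) u ^ 2 ∂P = ‖u‖ ^ 2 := by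
  simp only [inner_whitened]
  rw [integral_inner_sq_eq hx hid, ← norm_sq_sqrt_populationCov hx,
    toEuclideanLin_apply_inv_self (isUnit_det_sqrt_populationCov hx hcov)]

/-- Only the exponents `p = 2k` of the sub-gaussian norm are needed: `(√(2k) K)^(2k) = (2K²k)^k`. -/
theorem lintegral_inner_sq_pow_le {z : Ω → EuclideanSpace ℝ (Fin d)} {K : ℝ} (hK : 0 ≤ K)
    (hz : psi2Norm z P ≤ ENNReal.ofReal K) {u : EuclideanSpace ℝ (Fin d)} (hu : ‖u‖ = 1) {k : ℕ}
    (hk : 1 ≤ k) :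
    ∫⁻ ω, ENNReal.ofReal ((inner ℝ (z ω) u ^ 2) ^ k) ∂P ≤
      ENNReal.ofReal ((2 * K ^ 2 * k) ^ k) := by
  have hk' : (1 : ℝ) ≤ k := by exact_mod_cast hk
  set p : ℝ := ((2 * k : ℕ) : ℝ) with hp
  have hp2 : p = 2 * k := by rw [hp]; push_cast; ring
  have hp1 : 1 ≤ p := by rw [hp2]; linarith
  have hp0 : 0 < p := by linarith
  have hint (ω : Ω) : (inner ℝ (z ω) u ^ 2) ^ k = |inner ℝ (z ω) u| ^ p := by
    rw [hp, Real.rpow_natCast, pow_mul, sq_abs]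
  simp only [hint]
  set J := ∫⁻ ω, ENNReal.ofReal (|inner ℝ (z ω) u| ^ p) ∂P
  have h1 : ENNReal.ofReal (1 / √p) * J ^ (1 / p) ≤ ENNReal.ofReal K := by
    refine le_trans ?_ hz
    exact le_iSup₂_of_le u hu (le_iSup₂_of_le p hp1 le_rfl)
  have hsq : 0 < √p := Real.sqrt_pos.2 hp0
  have h2 : J ^ (1 / p) ≤ ENNReal.ofReal (√p * K) := by
    calc J ^ (1 / p) = ENNReal.ofReal (√p) * (ENNReal.ofReal (1 / √p) * J ^ (1 / p)) := by
          rw [← mul_assoc, ← ENNReal.ofReal_mul hsq.le, mul_one_div_cancel hsq.ne',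
            ENNReal.ofReal_one, one_mul]
      _ ≤ ENNReal.ofReal (√p) * ENNReal.ofReal K := by gcongr
      _ = _ := by rw [← ENNReal.ofReal_mul hsq.le]
  rw [one_div, ENNReal.rpow_inv_le_iff hp0,
    ENNReal.ofReal_rpow_of_nonneg (by positivity) hp0.le] at h2
  refine h2.trans_eq ?_
  congr 1
  rw [hp, Real.rpow_natCast, ← hp, pow_mul, mul_pow, Real.sq_sqrt hp0.le, hp2]
  ring

/-- Deviation of the whitened quadratic form in a fixed direction. -/
theorem measure_abs_whitened_form_ge_le [IsProbabilityMeasure P] (hn : 0 < n)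
    (hx : ∀ i, MemLp (x i) 2 P) (hind : iIndepFun x P)
    (hid : ∀ i j, IdentDistrib (x i) (x j) P P) (hcov : IsUnit (populationCov x P)) {K : ℝ}
    (hK : 0 ≤ K) (hz : ∀ i, psi2Norm (whitened x P i) P ≤ ENNReal.ofReal K)
    {u : EuclideanSpace ℝ (Fin d)} (hu : ‖u‖ = 1) {ε : ℝ} (hε : 0 ≤ ε) :
    P.real {ω | 10 * Real.exp 1 * K ^ 2 * max ε (ε ^ 2) ≤
        |(1 / (n : ℝ)) * ∑ i, inner ℝ (whitened x P i ω) u ^ 2 - 1|} ≤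
      2 * Real.exp (-(2 * (n * ε ^ 2))) := by
  have hY1 (i : Fin n) : ∫ ω, inner ℝ (whitened x P i ω) u ^ 2 ∂P = 1 := by
    rw [integral_inner_whitened_sq hx hid hcov, hu, one_pow]
  have hmom (i : Fin n) (k : ℕ) (hk : 1 ≤ k) := lintegral_inner_sq_pow_le hK (hz i) hu hk
  -- The case `k = 1` reads `1 ≤ 2K²`, by isotropy.
  have hK2 : 0 < K ^ 2 := by
    have h := hmom ⟨0, hn⟩ 1 le_rfl
    simp only [pow_one, Nat.cast_one, mul_one] at h
    rw [← ofReal_integral_eq_lintegral_ofReal (integrable_inner_whitened_sq hx _ u)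
      (Filter.Eventually.of_forall fun ω => sq_nonneg _), hY1,
      ENNReal.ofReal_le_ofReal_iff (by positivity)] at h
    linarith
  have hind' : iIndepFun (fun i ω => inner ℝ (whitened x P i ω) u ^ 2) P := by
    simp only [inner_whitened]
    exact hind.comp (fun _ y => inner ℝ y _ ^ 2) (fun _ => by fun_prop)
  exact measure_abs_average_sub_one_ge_le hn hind' (fun i => integrable_inner_whitened_sq hx i u)
    (fun i ω => sq_nonneg _) hY1 hK2 hmom hε

/-- If the whitened quadratic form is close to one on a `1/2`-net of the sphere, then the
eigenvalues of the empirical matrix are relatively close to those of the population matrix. -/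
theorem abs_eig_sub_le_of_net (hx : ∀ i, MemLp (x i) 2 P) (hcov : IsUnit (populationCov x P))
    {N : Finset (EuclideanSpace ℝ (Fin d))} (hN1 : ∀ u ∈ N, ‖u‖ = 1)
    (hN : ∀ v : EuclideanSpace ℝ (Fin d), ‖v‖ = 1 → ∃ u ∈ N, ‖u - v‖ ≤ 1 / 2)
    {D : ℝ} (hD : 0 ≤ D) {ω : Ω}
    (h : ∀ u ∈ N, |(1 / (n : ℝ)) * ∑ i, inner ℝ (whitened x P i ω) u ^ 2 - 1| ≤ D) (i : Fin d) :
    |eig (empiricalCov_isHermitian x ω) i - eig (populationCov_isHermitian x P) i| ≤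
      2 * D * eig (populationCov_isHermitian x P) i := by
  set T : EuclideanSpace ℝ (Fin d) →ₗ[ℝ] EuclideanSpace ℝ (Fin d) :=
    Matrix.toEuclideanLin (empiricalCov (whitened x P) ω) - LinearMap.id with hTdef
  have hT : T.IsSymmetric :=
    (Matrix.isSymmetric_toEuclideanLin_iff.2 (empiricalCov_isHermitian _ ω)).sub
      LinearMap.IsSymmetric.id
  have hTv (v : EuclideanSpace ℝ (Fin d)) : inner ℝ (T v) v =
      (1 / (n : ℝ)) * ∑ i, inner ℝ (whitened x P i ω) v ^ 2 - ‖v‖ ^ 2 := by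
    rw [hTdef, LinearMap.sub_apply, inner_sub_left, inner_toEuclideanLin_empiricalCov,
      LinearMap.id_apply, real_inner_self_eq_norm_sq]
  have hnet := hT.abs_inner_le_of_net hN1 hN (δ := D) fun u hu => by
    rw [hTv, hN1 u hu, one_pow]
    exact h u hu
  refine LinearMap.IsSymmetric.abs_eigenvalues_sub_le
    (Matrix.isSymmetric_toEuclideanLin_iff.2 (populationCov_isHermitian x P))
    (Matrix.isSymmetric_toEuclideanLin_iff.2 (empiricalCov_isHermitian x ω))
    finrank_euclideanSpace (fun v => ?_) (fun v => ?_) (by positivity) (fun v => ?_) _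
  · rw [← norm_sq_sqrt_populationCov hx]
    positivity
  · rw [inner_toEuclideanLin_empiricalCov]
    positivity
  -- Evaluating at `Σ^(1/2) v` undoes the whitening and turns `‖·‖²` into `⟨Σv,v⟩`.
  · have hv := hnet (Matrix.toEuclideanLin (CFC.sqrt (populationCov x P)) v)
    rw [hTv, norm_sq_sqrt_populationCov hx] at hv
    simp only [inner_whitened,
      toEuclideanLin_inv_apply_self (isUnit_det_sqrt_populationCov hx hcov)] at hv
    rwa [inner_toEuclideanLin_empiricalCov]

end Whitening

end RelDev

/-! ### Union bound over the net -/

theorem mainTheorem3 :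
    ∃ C : ℝ, 0 < C ∧
      ∀ (d n : ℕ), d ≤ n →
      ∀ (Ω : Type*) [MeasurableSpace Ω] (P : Measure Ω) [IsProbabilityMeasure P]
        (x : Fin n → Ω → EuclideanSpace ℝ (Fin d)),
        (∀ i, MemLp (x i) 2 P) →
        iIndepFun x P →
        (∀ i j, IdentDistrib (x i) (x j) P P) →
        IsUnit (RelDev.populationCov x P) →
        (∀ i, ∫ ω, x i ω ∂P = 0) →
        (∀ i, RelDev.IsSubGaussian (RelDev.whitened x P i) P) →
        ∀ K : ℝ, K = (⨆ i, RelDev.psi2Norm (RelDev.whitened x P i) P).toReal →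
        ∀ t : ℝ, 0 ≤ t →
        ∀ ε : ℝ, ε = √((d : ℝ) / n) + t / √(n : ℝ) →
          1 - 2 * Real.exp (-t ^ 2) ≤
            P.real {ω | ∀ i : Fin d,
              |RelDev.eig (RelDev.empiricalCov_isHermitian x ω) i
                  - RelDev.eig (RelDev.populationCov_isHermitian x P) i|
                ≤ C * K ^ 2 * RelDev.eig (RelDev.populationCov_isHermitian x P) i
                    * max ε (ε ^ 2)} := by
  -- The factor 2 comes from the net, `10e` from the Chernoff bound.
  refine ⟨2 * (10 * Real.exp 1), by positivity, ?_⟩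
  intro d n hdn Ω _ P _ x hx hind hid hcov _ hsub K hKdef t ht ε hεdef
  rcases Nat.eq_zero_or_pos d with rfl | hd
  · have : {ω : Ω | ∀ i : Fin 0,
        |RelDev.eig (RelDev.empiricalCov_isHermitian x ω) i
          - RelDev.eig (RelDev.populationCov_isHermitian x P) i|
        ≤ 2 * (10 * Real.exp 1) * K ^ 2 * RelDev.eig (RelDev.populationCov_isHermitian x P) i
          * max ε (ε ^ 2)} = Set.univ := Set.eq_univ_of_forall fun ω i => i.elim0
    rw [this, probReal_univ]
    linarith [Real.exp_pos (-t ^ 2)]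
  have hn : 0 < n := hd.trans_le hdn
  have hn' : (0 : ℝ) < n := by exact_mod_cast hn
  have hK0 : 0 ≤ K := hKdef ▸ ENNReal.toReal_nonneg
  have hε0 : 0 ≤ ε := by rw [hεdef]; positivity
  have hz (i : Fin n) : RelDev.psi2Norm (RelDev.whitened x P i) P ≤ ENNReal.ofReal K := by
    -- Finiteness matters because `toReal` sends `∞` to 0.
    have hfin : (⨆ i, RelDev.psi2Norm (RelDev.whitened x P i) P) ≠ ∞ := by
      have : Nonempty (Fin n) := ⟨i⟩
      obtain ⟨j, hj⟩ := exists_eq_ciSup_of_finite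
        (f := fun i => RelDev.psi2Norm (RelDev.whitened x P i) P)
      rw [← hj]
      exact (hsub j).ne
    rw [hKdef, ENNReal.ofReal_toReal hfin]
    exact le_iSup (fun i => RelDev.psi2Norm (RelDev.whitened x P i) P) i
  obtain ⟨N, hN1, hN, hNcard⟩ := exists_finset_sphere_net (EuclideanSpace ℝ (Fin d))
  rw [finrank_euclideanSpace, Fintype.card_fin] at hNcard
  set D := 10 * Real.exp 1 * K ^ 2 * max ε (ε ^ 2) with hDdef
  have hD0 : 0 ≤ D := by positivity
  set G := {ω : Ω | ∀ i : Fin d,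
    |RelDev.eig (RelDev.empiricalCov_isHermitian x ω) i
      - RelDev.eig (RelDev.populationCov_isHermitian x P) i|
    ≤ 2 * (10 * Real.exp 1) * K ^ 2 * RelDev.eig (RelDev.populationCov_isHermitian x P) i
      * max ε (ε ^ 2)} with hG
  let B : EuclideanSpace ℝ (Fin d) → Set Ω := fun u =>
    {ω | D ≤ |(1 / (n : ℝ)) * ∑ i, inner ℝ (RelDev.whitened x P i ω) u ^ 2 - 1|}
  -- Covering the space and using subadditivity avoids measurability of `G`.
  have hcover : (Set.univ : Set Ω) ⊆ G ∪ ⋃ u ∈ N, B u := by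
    intro ω _
    by_cases hω : ∀ u ∈ N,
        |(1 / (n : ℝ)) * ∑ i, inner ℝ (RelDev.whitened x P i ω) u ^ 2 - 1| ≤ D
    · left
      intro i
      refine (RelDev.abs_eig_sub_le_of_net hx hcov hN1 hN hD0 hω i).trans_eq ?_
      rw [hDdef]
      ring
    · right
      push Not at hω
      obtain ⟨u, huN, hu⟩ := hω
      exact Set.mem_biUnion (Finset.mem_coe.2 huN) hu.le
  have hnε : d + t ^ 2 ≤ n * ε ^ 2 := by
    have h1 : √(n : ℝ) * ε = √(d : ℝ) + t := by
      rw [hεdef, Real.sqrt_div (Nat.cast_nonneg d)]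
      field_simp
    calc (d : ℝ) + t ^ 2 ≤ (√(d : ℝ) + t) ^ 2 := by
          rw [add_sq, Real.sq_sqrt (Nat.cast_nonneg d)]
          have : 0 ≤ 2 * √(d : ℝ) * t := by positivity
          linarith
      _ = _ := by rw [← h1, mul_pow, Real.sq_sqrt hn'.le]
  have hbad : P.real (⋃ u ∈ N, B u) ≤ 2 * Real.exp (-t ^ 2) := by
    -- Hence `5^d ≤ exp(2d)`, cancelling the `d` part of `exp(-2(d + t²))`.
    have he5 : (5 : ℝ) ≤ Real.exp 2 := by
      have h1 : Real.exp 2 = Real.exp 1 * Real.exp 1 := by rw [← Real.exp_add]; norm_num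
      rw [h1]
      nlinarith [Real.exp_one_gt_d9]
    calc P.real (⋃ u ∈ N, B u) ≤ ∑ u ∈ N, P.real (B u) := measureReal_biUnion_finset_le N B
      _ ≤ ∑ _u ∈ N, 2 * Real.exp (-(2 * (n * ε ^ 2))) := Finset.sum_le_sum fun u hu =>
          RelDev.measure_abs_whitened_form_ge_le hn hx hind hid hcov hK0 hz (hN1 u hu) hε0
      _ = N.card * (2 * Real.exp (-(2 * (n * ε ^ 2)))) := by
          rw [Finset.sum_const, nsmul_eq_mul]
      _ ≤ Real.exp 2 ^ d * (2 * Real.exp (-(2 * (d + t ^ 2)))) := by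
          refine mul_le_mul ?_ ?_ (by positivity) (by positivity)
          · calc (N.card : ℝ) ≤ 5 ^ d := by exact_mod_cast hNcard
              _ ≤ _ := pow_le_pow_left₀ (by norm_num) he5 d
          · gcongr
      _ = 2 * Real.exp (-(2 * t ^ 2)) := by
          rw [← Real.exp_nat_mul, mul_left_comm, ← Real.exp_add]
          ring_nf
      _ ≤ _ := by
          gcongr
          nlinarith [sq_nonneg t]
  have hone : 1 ≤ P.real G + P.real (⋃ u ∈ N, B u) := by
    rw [← probReal_univ (μ := P)]
    exact (measureReal_mono hcover).trans (measureReal_union_le _ _)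
  linarith
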